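/- Let $W$ be a Weyl group of rank $n$: let $\Phi$ be a finite reduced crystallographic root system spanning an $n$-dimensional real inner product space $E$, where $W$ is generated by the reflections $s_r$ $(r\in\Phi)$ and the inner product is $W$-invariant. The root zonotope $Z_W=\sum_{r\in\Phi^+}[0,r]\subset E$ is the Minkowski sum of the segments $[0,r]$ over the positive roots $r$ (for any choice of simple roots). A reflection subgroup $W'\le W$ is a subgroup generated by some of the reflections $s_r$, $r\in\Phi$. Put $\Phi'=\{r\in\Phi: s_r\in W'\}$; $W'$ has maximal rank if $\Phi'$ spans $E$. Its coroot lattice is $\widehat{Q'}=\sum_{r\in\Phi'}\mathbb{Z}\,\frac{2r}{\langle r,r\rangle}$, and for $W'$ of maximal rank $\operatorname{vol}(\widehat{Q'})$ denotes the covolume of this lattice, i.e. the volume of the parallelepiped spanned by a $\mathbb{Z}$-basis. The multiset $\{h_i(W')\}$ of Coxeter numbers of $W'$ contains, for each irreducible component of $W'$, its Coxeter number $h$ with multiplicity equal to the rank of the component; here $h=2N/m$ for a component of rank $m$ with $N$ reflections. Order the set of maximal rank reflection subgroups of $W$ by reverse inclusion and let $\mu$ be the Möbius function of this poset. Then $$\operatorname{Vol}(Z_W)=\sum_{W''\le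 W}\Big(\prod_{i=1}^n h_i(W'')\Big)\sum_{W''\le W'\le W}\mu(W',W'')\cdot\frac{1}{\operatorname{vol}(\widehat{Q'})},$$ where $W''$ and $W'$ run over the maximal rank reflection subgroups of $W$, and $\le$ under the sums denotes inclusion of subgroups. -/

import Mathlib

open MeasureTheory RootPairing OrderDual
open scoped Pointwise RealInnerProductSpace

noncomputable section

namespace WeylZonotope

/-- The zonotope of a finite family of real vectors: the Minkowski sum of the segments `[0, v i]`,
`i ∈ s` (the empty sum is `{0}`). -/
def zonotope {ι E : Type*} [AddCommGroup E] [Module ℝ E] (s : Finset ι) (v : ι → E) : Set E :=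
  ∑ i ∈ s, segment ℝ 0 (v i)

/-- The Möbius function of a finite partially ordered set. -/
def moebius {α : Type*} [PartialOrder α] [Finite α] (a b : α) : ℤ := by
  classical
  exact
    letI : Fintype α := Fintype.ofFinite α
    letI : LocallyFiniteOrder α := Fintype.toLocallyFiniteOrder
    IncidenceAlgebra.mu ℤ a b

section RootSystem

variable {ι E N : Type*} [NormedAddCommGroup E] [InnerProductSpace ℝ E] [AddCommGroup N]
  [Module ℝ N]

/-- The root zonotope: the zonotope of the positive roots (with respect to a chosen base). -/
def rootZonotope [Finite ι] (P : RootPairing ι ℝ E N) (b : P.Base) : Set E := by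
  classical
  exact
    letI : Fintype ι := Fintype.ofFinite ι
    zonotope {i | b.IsPos i} P.root

variable (P : RootPairing ι ℝ E N)

/-- The (indices of the) roots whose reflection lies in the subgroup `H` of the Weyl group. -/
def rootIndices (H : Subgroup P.weylGroup) : Set ι := {i | weylGroup.ofIdx P i ∈ H}

/-- `H` is a reflection subgroup: it is generated by the reflections that it contains. -/
def IsReflectionSubgroup (H : Subgroup P.weylGroup) : Prop :=
  Subgroup.closure (weylGroup.ofIdx P '' rootIndices P H) = H

/-- The rank of a set of roots: the dimension of its span. -/
def rootRank (C : Set ι) : ℕ := Module.finrank ℝ (Submodule.span ℝ (P.root '' C))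

/-- The reflection subgroups of the Weyl group whose rank is maximal, that is, whose roots span `E`
(equivalently, which fix no nonzero vector), partially ordered by inclusion. -/
abbrev MaxRankReflectionSubgroup : Type _ :=
  {H : Subgroup P.weylGroup //
    IsReflectionSubgroup P H ∧ rootRank P (rootIndices P H) = Module.finrank ℝ E}

instance [Finite ι] : Finite (MaxRankReflectionSubgroup P) := by
  refine Finite.of_injective (fun H => rootIndices P H.1) fun H K h => Subtype.ext ?_
  have hH : Subgroup.closure (weylGroup.ofIdx P '' rootIndices P H.1) = H.1 := H.2.1
  have hK : Subgroup.closure (weylGroup.ofIdx P '' rootIndices P K.1) = K.1 := K.2.1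
  have h' : rootIndices P H.1 = rootIndices P K.1 := h
  rw [← hH, ← hK, h']

instance [Finite ι] : Fintype (MaxRankReflectionSubgroup P) := Fintype.ofFinite _

/-- Non-orthogonality of the roots of `H`. The connected components of this graph are the
irreducible components of the root system of `H`; the reflections in the roots of a component
are the reflections of the corresponding irreducible factor of `H`. -/
def nonOrthogonalityGraph (H : Subgroup P.weylGroup) : SimpleGraph (rootIndices P H) :=
  SimpleGraph.fromRel fun i j => P.pairing i j ≠ 0

/-- The (indices of the) roots in an irreducible component of the root system of `H`. -/
def componentRoots (H : Subgroup P.weylGroup) (c : (nonOrthogonalityGraph P H).ConnectedComponent) :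
    Set ι :=
  Subtype.val '' c.supp

/-- The Coxeter number `h = 2N/n` of an irreducible component with set of roots `C`, where `N` is
the number of its reflections and `n` is its rank. -/
def coxeterNumber (C : Set ι) : ℝ :=
  2 * (weylGroup.ofIdx P '' C).ncard / rootRank P C

/-- The multiset of Coxeter numbers of `H`: the Coxeter number of each irreducible component,
taken with multiplicity equal to the rank of the component. -/
def coxeterNumbers [Finite ι] (H : Subgroup P.weylGroup) : Multiset ℝ :=
  letI : Fintype (nonOrthogonalityGraph P H).ConnectedComponent :=
    @Fintype.ofFinite _ (Quot.finite _)
  ∑ c : (nonOrthogonalityGraph P H).ConnectedComponent,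
    Multiset.replicate (rootRank P (componentRoots P H c))
      (coxeterNumber P (componentRoots P H c))

/-- The coroot lattice of `H`: the `ℤ`-span of the coroots `2r / ⟨r, r⟩` of the roots `r` of `H`.
For a Weyl-invariant inner product these vectors represent the functionals `P.coroot i`. -/
def corootLattice (H : Subgroup P.weylGroup) : Submodule ℤ E :=
  Submodule.span ℤ ((fun i => (2 / ⟪P.root i, P.root i⟫) • P.root i) '' rootIndices P H)

end RootSystem

end WeylZonotope

end

/-! The volume of a zonotope in dimension `n` is the sum of `|det|` over the `n`-element subsets of
its generators (`factorial_mul_volume_zonotope`). For the root zonotope only bases of positive roots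
contribute. The reflections in such a basis generate a reflection subgroup of maximal rank, so the
volume is distributed over these subgroups.

For each maximal rank `W''`, the Laplacian `∑ (1 - s_r)` over the positive roots of `W''` acts on
each irreducible component as the scalar `h`. Its determinant is therefore the product of the
Coxeter numbers (`det_laplacian`). Cauchy-Binet expands the same determinant over the bases of
positive roots in `W''`, each contributing `det(roots) * det(coroots)`. The two factors have the
same sign, since coroots are positive multiples of roots.

The arithmetic input is `innerCoroot_mem_span`: the coroots of a basis of roots already span the
coroot lattice of the subgroup generated by their reflections. Hence `|det(coroots)|` is the
covolume of that lattice and depends only on the subgroup. So `∏ h_i(W'')` sums, over all generated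
subgroups inside `W''`, their share of the volume weighted by the covolume. Möbius inversion
recovers each share (`sum_eq_sum_moebius`), and dividing by the covolumes gives the formula.

All sums run over ordered tuples instead of subsets, which puts a factor `n!` on both sides. -/

namespace WeylZonotope

/-! ### Cauchy-Binet and sums over tuples -/

section CauchyBinet

open Finset Matrix

variable {ι : Type*}

/-- The Cauchy-Binet formula, summed over all (not necessarily increasing) tuples of indices. -/
theorem factorial_mul_det_sum_vecMulVec {n : ℕ} (s : Finset ι) (a b : ι → Fin n → ℝ) :
    (n.factorial : ℝ) * (∑ i ∈ s, vecMulVec (a i) (b i)).det =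
      ∑ f ∈ Fintype.piFinset fun _ : Fin n => s,
        (Matrix.of fun j => a (f j)).det * (Matrix.of fun j => b (f j)).det := by
  -- Row `p` of the matrix is `∑ i, a i p • b i`; this is multilinearity in the rows.
  have expand : (∑ i ∈ s, vecMulVec (a i) (b i)).det =
      ∑ f ∈ Fintype.piFinset fun _ : Fin n => s,
        (∏ p, a (f p) p) * (Matrix.of fun j => b (f j)).det := by
    have h : (∑ i ∈ s, vecMulVec (a i) (b i)) = Matrix.of fun p => ∑ i ∈ s, a i p • b i := by
      ext p q
      simp [Matrix.sum_apply, vecMulVec_apply]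
    rw [h]
    change (detRowAlternating : (Fin n → ℝ) [⋀^Fin n]→ₗ[ℝ] ℝ).toMultilinearMap
      (fun p => ∑ i ∈ s, a i p • b i) = _
    rw [MultilinearMap.map_sum_finset]
    refine Finset.sum_congr rfl fun f _ => ?_
    rw [MultilinearMap.map_smul_univ]
    rfl
  -- Permuting the tuple by `π` moves a sign out of the second determinant. Summing over all `n!`
  -- permutations then assembles the products of entries of `a` into a determinant.
  have key : ∀ π : Equiv.Perm (Fin n), (∑ i ∈ s, vecMulVec (a i) (b i)).det =
      ∑ f ∈ Fintype.piFinset fun _ : Fin n => s,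
        ((Equiv.Perm.sign π : ℤ) : ℝ) * (∏ p, a (f (π p)) p) *
          (Matrix.of fun j => b (f j)).det := by
    intro π
    rw [expand]
    refine (Finset.sum_equiv (Equiv.arrowCongr π.symm (Equiv.refl ι)) (fun f => ?_)
      fun f _ => ?_).symm
    · simp only [Fintype.mem_piFinset, Equiv.arrowCongr_apply, Equiv.coe_refl, Function.comp,
        id, Equiv.symm_symm]
      exact ⟨fun h i => h _, fun h i => by simpa using h (π.symm i)⟩
    · have := Matrix.det_permute π (Matrix.of fun j => b (f j))
      have h2 : ((Matrix.of fun j => b (f j)).submatrix π id) =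
          Matrix.of fun j => b ((Equiv.arrowCongr π.symm (Equiv.refl ι)) f j) := by
        ext; simp
      rw [h2] at this
      rw [this]
      simp
      ring
  have hcard : (n.factorial : ℝ) = ∑ _π : Equiv.Perm (Fin n), (1 : ℝ) := by
    simp [Finset.card_univ, Fintype.card_perm]
  rw [hcard, Finset.sum_mul]
  simp only [one_mul]
  rw [Finset.sum_congr rfl fun π _ => key π, Finset.sum_comm]
  refine Finset.sum_congr rfl fun f _ => ?_
  rw [← Finset.sum_mul]
  congr 1
  rw [Matrix.det_apply]
  refine Finset.sum_congr rfl fun π _ => ?_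
  simp [Units.smul_def]

/-- Splitting a sum over tuples according to whether the tuple uses a new index, for a summand
which vanishes on tuples with a repeated index and is invariant under permutations. -/
theorem sum_piFinset_insert [DecidableEq ι] {n : ℕ} {s : Finset ι} {x : ι} (hx : x ∉ s)
    (F : (Fin (n + 1) → ι) → ℝ) (hF : ∀ f i j, i ≠ j → f i = f j → F f = 0)
    (hperm : ∀ f (π : Equiv.Perm (Fin (n + 1))), F (f ∘ π) = F f) :
    ∑ f ∈ Fintype.piFinset fun _ : Fin (n + 1) => insert x s, F f =
      ∑ f ∈ Fintype.piFinset fun _ : Fin (n + 1) => s, F f +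
        (n + 1) * ∑ g ∈ Fintype.piFinset fun _ : Fin n => s, F (Fin.cons x g) := by
  have hsub : (Fintype.piFinset fun _ : Fin (n + 1) => s) ⊆
      Fintype.piFinset fun _ : Fin (n + 1) => insert x s :=
    Fintype.piFinset_subset _ _ fun _ => Finset.subset_insert _ _
  -- Where `F f ≠ 0` the tuple has no repetition, so `x` occupies at most one slot and the sum over
  -- `j` has at most one nonzero term.
  have hpt : ∀ f ∈ Fintype.piFinset fun _ : Fin (n + 1) => insert x s,
      F f = (if f ∈ Fintype.piFinset fun _ : Fin (n + 1) => s then F f else 0) +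
        ∑ j, if f j = x then F f else 0 := by
    intro f hf
    by_cases h0 : F f = 0
    · simp [h0]
    by_cases hj : ∃ j, f j = x
    · obtain ⟨j, hj⟩ := hj
      have h1 : f ∉ Fintype.piFinset fun _ : Fin (n + 1) => s := fun h =>
        hx (hj ▸ Fintype.mem_piFinset.1 h j)
      rw [if_neg h1, Finset.sum_eq_single j, if_pos hj, zero_add]
      · intro k _ hk
        rw [if_neg fun h => h0 (hF f k j hk (h.trans hj.symm))]
      · simp
    · push Not at hj
      have h1 : f ∈ Fintype.piFinset fun _ : Fin (n + 1) => s := Fintype.mem_piFinset.2 fun j =>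
        (Finset.mem_insert.1 (Fintype.mem_piFinset.1 hf j)).resolve_left (hj j)
      rw [if_pos h1, Finset.sum_eq_zero fun j _ => if_neg (hj j), add_zero]
  -- A cycle moves slot `j` to the front, so every slot contributes equally; this is the source of
  -- the factor `n + 1`.
  have hslot : ∀ j : Fin (n + 1),
      ∑ f ∈ Fintype.piFinset fun _ : Fin (n + 1) => insert x s, (if f j = x then F f else 0) =
        ∑ g ∈ Fintype.piFinset fun _ : Fin n => s, F (Fin.cons x g) := by
    intro j
    have h1 : ∑ g ∈ Fintype.piFinset fun _ : Fin n => s, F (Fin.cons x g) =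
        ∑ g ∈ Fintype.piFinset fun _ : Fin n => s,
          (fun f : Fin (n + 1) → ι => if f j = x then F f else 0) (j.insertNth x g) := by
      refine Finset.sum_congr rfl fun g _ => ?_
      have := hperm (j.insertNth x g : Fin (n + 1) → ι) j.cycleRange.symm
      rw [Fin.insertNth_comp_cycleRange_symm] at this
      simp [this]
    rw [h1, ← Finset.sum_image
      (f := fun f : Fin (n + 1) → ι => if f j = x then F f else 0)
      (g := fun g : Fin n → ι => (j.insertNth x g : Fin (n + 1) → ι))
      fun g _ g' _ h => Fin.insertNth_right_injective _ h]
    symm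
    apply Finset.sum_subset
    · intro f hf
      obtain ⟨g, hg, rfl⟩ := Finset.mem_image.1 hf
      rw [Fintype.mem_piFinset] at hg ⊢
      intro k
      refine Fin.succAboveCases j ?_ (fun k => ?_) k
      · simp
      · simpa using Or.inr (hg k)
    · intro f hf hf'
      split_ifs with hfj
      · by_contra h0
        refine hf' (Finset.mem_image.2 ⟨j.removeNth f, ?_, ?_⟩)
        · rw [Fintype.mem_piFinset] at hf ⊢
          intro k
          refine (Finset.mem_insert.1 (hf _)).resolve_left fun h => h0 (hF f (j.succAbove k) j
            (Fin.succAbove_ne j k) (h.trans hfj.symm))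
        · simp [← hfj]
      · rfl
  rw [Finset.sum_congr rfl hpt, Finset.sum_add_distrib, Finset.sum_comm]
  simp only [hslot]
  congr 1
  · rw [← Finset.sum_filter, Finset.filter_mem_eq_inter, Finset.inter_eq_right.2 hsub]
  · simp

end CauchyBinet

/-! ### Elementary properties of zonotopes -/

section Zonotope

variable {ι E F : Type*} [AddCommGroup E] [Module ℝ E] [AddCommGroup F] [Module ℝ F]

theorem zonotope_empty (v : ι → E) : zonotope ∅ v = {0} := by
  simp [zonotope, Set.singleton_zero]

theorem zonotope_insert [DecidableEq ι] {s : Finset ι} {x : ι} (hx : x ∉ s) (v : ι → E) :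
    zonotope (insert x s) v = zonotope s v + segment ℝ 0 (v x) := by
  rw [zonotope, Finset.sum_insert hx, add_comm, zonotope]

theorem image_zonotope (L : E →ₗ[ℝ] F) (s : Finset ι) (v : ι → E) :
    L '' zonotope s v = zonotope s fun i => L (v i) := by
  classical
  induction s using Finset.induction_on with
  | empty => simp [zonotope_empty]
  | insert x s hx ih =>
    rw [zonotope_insert hx, zonotope_insert hx, Set.image_add, ih]
    congr 1
    simpa using image_segment ℝ L.toAffineMap 0 (v x)

theorem convex_zonotope (s : Finset ι) (v : ι → E) : Convex ℝ (zonotope s v) := by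
  classical
  induction s using Finset.induction_on with
  | empty => simp [zonotope_empty, convex_singleton]
  | insert x s hx ih => rw [zonotope_insert hx]; exact ih.add (convex_segment _ _)

theorem zonotope_nonempty (s : Finset ι) (v : ι → E) : (zonotope s v).Nonempty := by
  classical
  induction s using Finset.induction_on with
  | empty => simp [zonotope_empty]
  | insert x s hx ih => rw [zonotope_insert hx]; exact ih.add ⟨0, left_mem_segment ℝ _ _⟩

theorem isCompact_zonotope [TopologicalSpace E] [IsTopologicalAddGroup E] [ContinuousSMul ℝ E]
    (s : Finset ι) (v : ι → E) : IsCompact (zonotope s v) := by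
  classical
  induction s using Finset.induction_on with
  | empty => simp [zonotope_empty]
  | insert x s hx ih =>
    rw [zonotope_insert hx]
    refine ih.add ?_
    rw [segment_eq_image]
    exact isCompact_Icc.image (by fun_prop)

end Zonotope

/-! ### Volume of a convex body plus a segment -/

section Volume

theorem volume_add_Icc {A : Set ℝ} (hA : IsCompact A) (hc : Convex ℝ A) (hne : A.Nonempty) :
    volume (A + Set.Icc 0 1) = volume A + 1 := by
  rw [eq_Icc_of_connected_compact ⟨hne, hc.isPreconnected⟩ hA]
  have h := Real.sInf_le_sSup A hA.bddBelow hA.bddAbove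
  rw [Set.Icc_add_Icc h zero_le_one, Real.volume_Icc, Real.volume_Icc, ← ENNReal.ofReal_one,
    ← ENNReal.ofReal_add (by linarith) zero_le_one]
  congr 1
  ring

/-- Adding a unit segment in the first direction to a compact convex set increases its volume by
the volume of the projection along this direction. -/
theorem volume_prod_add_Icc {Y : Type*} [NormedAddCommGroup Y] [NormedSpace ℝ Y]
    [MeasurableSpace Y] [BorelSpace Y] [SecondCountableTopology Y] (μ : Measure Y) [SFinite μ]
    {K : Set (ℝ × Y)} (hK : IsCompact K) (hc : Convex ℝ K) :
    (volume.prod μ) (K + Set.Icc 0 1 ×ˢ {0}) = (volume.prod μ) K + μ (Prod.snd '' K) := by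
  have hK' : IsCompact (K + Set.Icc (0 : ℝ) 1 ×ˢ {(0 : Y)}) :=
    hK.add (isCompact_Icc.prod isCompact_singleton)
  have himg : MeasurableSet (Prod.snd '' K) := (hK.image continuous_snd).measurableSet
  -- By Fubini it suffices to compare slices: each nonempty slice is a compact interval and gets
  -- longer by exactly one, while empty slices stay empty.
  rw [Measure.prod_apply_symm hK'.measurableSet, Measure.prod_apply_symm hK.measurableSet,
    ← lintegral_indicator_one himg, ← lintegral_add_right _ (measurable_one.indicator himg)]
  refine lintegral_congr fun y => ?_
  have hslice : (fun t => (t, y)) ⁻¹' (K + Set.Icc (0 : ℝ) 1 ×ˢ {(0 : Y)}) =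
      (fun t => (t, y)) ⁻¹' K + Set.Icc (0 : ℝ) 1 := by
    ext t
    simp only [Set.mem_preimage, Set.mem_add, Set.mem_prod, Set.mem_singleton_iff, Prod.exists]
    constructor
    · rintro ⟨a, z, h, c, w, ⟨hc, rfl⟩, h'⟩
      simp only [Prod.mk_add_mk, Prod.mk.injEq, add_zero] at h'
      obtain ⟨rfl, rfl⟩ := h'
      exact ⟨a, h, c, hc, rfl⟩
    · rintro ⟨a, h, c, hc, rfl⟩
      exact ⟨a, y, h, c, 0, ⟨hc, rfl⟩, by simp⟩
  rw [hslice]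
  by_cases hy : y ∈ Prod.snd '' K
  · obtain ⟨⟨t, y⟩, ht, rfl⟩ := hy
    have hcpt : IsCompact ((fun t => (t, y)) ⁻¹' K) := by
      have : (fun t => (t, y)) ⁻¹' K = Prod.fst '' (K ∩ Prod.snd ⁻¹' {y}) := by
        ext t
        simp
      rw [this]
      exact (hK.inter_right (isClosed_singleton.preimage continuous_snd)).image continuous_fst
    have hcvx : Convex ℝ ((fun t => (t, y)) ⁻¹' K) := by
      intro a ha c hc' p q hp hq hpq
      have := hc ha hc' hp hq hpq
      simpa [← add_smul, hpq] using this
    rw [volume_add_Icc hcpt hcvx ⟨t, ht⟩, Set.indicator_of_mem (Set.mem_image_of_mem Prod.snd ht)]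
    rfl
  · have hemp : (fun t => (t, y)) ⁻¹' K = ∅ := by
      ext t
      simp only [Set.mem_preimage, Set.mem_empty_iff_false, iff_false]
      exact fun h => hy ⟨(t, y), h, rfl⟩
    rw [hemp, Set.indicator_of_notMem hy]
    simp

theorem volume_add_segment_single {n : ℕ} {K : Set (Fin (n + 1) → ℝ)} (hK : IsCompact K)
    (hc : Convex ℝ K) :
    volume (K + segment ℝ 0 (Pi.single 0 1)) = volume K + volume (Fin.tail '' K) := by
  let e : (Fin (n + 1) → ℝ) ≃ᵐ ℝ × (Fin n → ℝ) :=
    MeasurableEquiv.piFinSuccAbove (fun _ => ℝ) 0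
  have he : MeasurePreserving e := volume_preserving_piFinSuccAbove (fun _ => ℝ) 0
  let L : (Fin (n + 1) → ℝ) →ₗ[ℝ] ℝ × (Fin n → ℝ) :=
    (LinearMap.proj 0).prod (LinearMap.funLeft ℝ ℝ Fin.succ)
  have heL : ⇑e = L := by
    ext x
    · rfl
    · rfl
  have hvol : ∀ S : Set (Fin (n + 1) → ℝ), volume S = volume (L '' S) := by
    intro S
    rw [← he.measure_preimage_equiv, ← heL, e.injective.preimage_image]
  have hLc : Continuous L := L.continuous_of_finiteDimensional
  have hseg : L '' segment ℝ 0 (Pi.single 0 1) = Set.Icc (0 : ℝ) 1 ×ˢ {(0 : Fin n → ℝ)} := by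
    rw [segment_eq_image, Set.image_image]
    ext ⟨t, y⟩
    simp only [Set.mem_image, Set.mem_prod, Set.mem_singleton_iff]
    have hL1 : L (Pi.single 0 1) = (1, 0) := by
      ext i
      · simp [L]
      · simp [L, LinearMap.funLeft_apply]
    constructor
    · rintro ⟨θ, hθ, h⟩
      simp only [smul_zero, zero_add, map_smul, hL1, Prod.smul_mk, smul_eq_mul, mul_one,
        Prod.mk.injEq] at h
      exact ⟨h.1 ▸ hθ, h.2.symm⟩
    · rintro ⟨ht, rfl⟩
      exact ⟨t, ht, by simp [hL1]⟩
  rw [hvol, hvol K, Set.image_add, hseg]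
  have := volume_prod_add_Icc (volume : Measure (Fin n → ℝ)) (hK.image hLc) (hc.linear_image L)
  rw [Set.image_image] at this
  exact this

end Volume

/-! ### Volume of a zonotope -/

section Volume

open Matrix

variable {ι : Type*}

theorem volume_zonotope_empty {n : ℕ} (v : ι → Fin n → ℝ) :
    (n.factorial : ℝ) * volume.real (zonotope ∅ v) =
      ∑ f ∈ Fintype.piFinset fun _ : Fin n => (∅ : Finset ι), |(Matrix.of fun j => v (f j)).det| := by
  rw [zonotope_empty]
  rcases n with _ | n
  -- In dimension zero the point has volume 1, matching the single empty tuple and the empty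
  -- determinant.
  · have h : ({0} : Set (Fin 0 → ℝ)) = Set.univ.pi fun _ => Set.Icc 0 1 :=
      (Set.eq_univ_of_forall fun x => Subsingleton.elim _ _).trans
        (Set.eq_univ_of_forall fun x i => i.elim0).symm
    rw [h, measureReal_def, volume_pi_pi]
    simp
  · simp [measureReal_def]

/-- The volume of a zonotope, as a sum over tuples of generators. -/
theorem factorial_mul_volume_zonotope (n : ℕ) (s : Finset ι) (v : ι → Fin n → ℝ) :
    (n.factorial : ℝ) * volume.real (zonotope s v) =
      ∑ f ∈ Fintype.piFinset fun _ : Fin n => s, |(Matrix.of fun j => v (f j)).det| := by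
  classical
  -- Adding a generator adds the volume of the projection along it, which is a zonotope one
  -- dimension lower. Hence an outer induction on the dimension and an inner one on the generators.
  induction n generalizing s with
  | zero =>
    have h : zonotope s v = zonotope ∅ v := by
      rw [zonotope_empty, Set.eq_singleton_iff_nonempty_unique_mem]
      exact ⟨zonotope_nonempty _ _, fun x _ => Subsingleton.elim _ _⟩
    rw [h, volume_zonotope_empty]
    simp
  | succ n ihn =>
    induction s using Finset.induction_on with
    | empty => exact volume_zonotope_empty v
    | insert x s hx ih =>
      rw [zonotope_insert hx, sum_piFinset_insert hx, ← ih]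
      rotate_left
      · intro f i j hij h
        rw [Matrix.det_zero_of_row_eq hij (by ext k; simp [Matrix.of_apply, h]), abs_zero]
      · intro f π
        have := Matrix.det_permute π (Matrix.of fun j => v (f j))
        have h2 : ((Matrix.of fun j => v (f j)).submatrix π id) =
            Matrix.of fun j => v ((f ∘ π) j) := by
          ext; simp
        rw [← h2, this, abs_mul]
        rcases Int.units_eq_one_or (Equiv.Perm.sign π) with h | h <;> simp [h]
      by_cases h0 : v x = 0
      · have hz : ∀ g : Fin n → ι,
            (Matrix.of fun j => v ((Fin.cons x g : Fin (n + 1) → ι) j)).det = 0 := fun g =>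
          Matrix.det_eq_zero_of_row_eq_zero 0 (by simp [h0])
        simp [h0, hz, segment_same]
      -- A linear automorphism straightens the new generator to the first unit vector; both sides
      -- scale by `|det A|`.
      obtain ⟨A, hA⟩ : ∃ A : (Fin (n + 1) → ℝ) ≃ₗ[ℝ] (Fin (n + 1) → ℝ),
          A (v x) = Pi.single 0 1 := by
        obtain ⟨A, hA⟩ := SeparatingDual.exists_continuousLinearEquiv_apply_eq (R := ℝ) h0
          (y := (Pi.single 0 1 : Fin (n + 1) → ℝ)) (by simp)
        exact ⟨A.toLinearEquiv, hA⟩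
      set d := LinearMap.det (A : (Fin (n + 1) → ℝ) →ₗ[ℝ] (Fin (n + 1) → ℝ)) with hd
      have hd0 : d ≠ 0 := A.isUnit_det'.ne_zero
      have hvol : ∀ S : Set (Fin (n + 1) → ℝ), volume.real (A '' S) = |d| * volume.real S := by
        intro S
        have := Measure.addHaar_image_linearMap (volume : Measure (Fin (n + 1) → ℝ))
          (A : (Fin (n + 1) → ℝ) →ₗ[ℝ] (Fin (n + 1) → ℝ)) S
        rw [measureReal_def, measureReal_def, ← abs_of_nonneg (abs_nonneg d),
          ← ENNReal.toReal_ofReal (abs_nonneg |d|), ← ENNReal.toReal_mul, abs_abs, ← this]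
        rfl
      have himg : A '' zonotope s v = zonotope s fun i => A (v i) :=
        image_zonotope (A : (Fin (n + 1) → ℝ) →ₗ[ℝ] (Fin (n + 1) → ℝ)) s v
      have htail : Fin.tail '' (zonotope s fun i => A (v i)) =
          zonotope s fun i => Fin.tail (A (v i)) :=
        image_zonotope (LinearMap.funLeft ℝ ℝ Fin.succ) s fun i => A (v i)
      have hcpt := isCompact_zonotope s fun i => A (v i)
      have hadd : volume.real (A '' (zonotope s v + segment ℝ 0 (v x))) =
          volume.real (A '' zonotope s v) + volume.real (zonotope s fun i => Fin.tail (A (v i))) := by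
        have hseg : A '' segment ℝ 0 (v x) = segment ℝ 0 (Pi.single 0 1) := by
          have := image_segment ℝ
            (A : (Fin (n + 1) → ℝ) →ₗ[ℝ] (Fin (n + 1) → ℝ)).toAffineMap 0 (v x)
          simpa [hA] using this
        rw [Set.image_add, hseg, himg, measureReal_def,
          volume_add_segment_single hcpt (convex_zonotope s _), htail,
          ENNReal.toReal_add hcpt.measure_ne_top (isCompact_zonotope s _).measure_ne_top]
        rfl
      -- After applying `A` the first row is a unit vector, so Laplace expansion leaves the minor of
      -- the projected generators.
      have hdet : ∀ g : Fin n → ι,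
          |d| * |(Matrix.of fun j => v ((Fin.cons x g : Fin (n + 1) → ι) j)).det| =
            |(Matrix.of fun j => Fin.tail (A (v (g j)))).det| := by
        intro g
        rw [← abs_mul]
        congr 1
        have h1 : (Matrix.of fun j => v ((Fin.cons x g : Fin (n + 1) → ι) j)) *
            (LinearMap.toMatrix' (A : (Fin (n + 1) → ℝ) →ₗ[ℝ] (Fin (n + 1) → ℝ)))ᵀ =
            Matrix.of fun j => A (v ((Fin.cons x g : Fin (n + 1) → ι) j)) := by
          ext j k
          have := congrFun (LinearMap.toMatrix'_mulVec
            (A : (Fin (n + 1) → ℝ) →ₗ[ℝ] (Fin (n + 1) → ℝ))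
            (v ((Fin.cons x g : Fin (n + 1) → ι) j))) k
          simp only [LinearEquiv.coe_coe] at this
          simp only [Matrix.mul_apply, Matrix.of_apply, Matrix.transpose_apply]
          rw [← this]
          simp only [Matrix.mulVec, dotProduct]
          exact Finset.sum_congr rfl fun _ _ => mul_comm _ _
        have h2 : d * (Matrix.of fun j => v ((Fin.cons x g : Fin (n + 1) → ι) j)).det =
            (Matrix.of fun j => A (v ((Fin.cons x g : Fin (n + 1) → ι) j))).det := by
          rw [← h1, Matrix.det_mul, Matrix.det_transpose, LinearMap.det_toMatrix', mul_comm]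
        rw [h2, Matrix.det_succ_row_zero, Finset.sum_eq_single 0]
        · simp only [Fin.val_zero, pow_zero, one_mul, Matrix.of_apply, Fin.cons_zero, hA,
            Pi.single_eq_same]
          congr 1
        · intro j _ hj
          simp [hA, hj]
        · simp
      rw [hvol, hvol] at hadd
      have hn := ihn s fun i => Fin.tail (A (v i))
      have hd' : |d| ≠ 0 := abs_ne_zero.2 hd0
      apply mul_left_cancel₀ hd'
      rw [mul_left_comm, hadd, mul_add, mul_add |d|, mul_left_comm |d|,
        mul_left_comm |d|, Finset.mul_sum, Finset.sum_congr rfl fun g _ => hdet g, ← hn,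
        Nat.factorial_succ]
      push_cast
      ring

end Volume

/-! ### Coroot lattices of subgroups generated by a basis of roots -/

section RootLattice

variable {ι E N : Type*} [NormedAddCommGroup E] [InnerProductSpace ℝ E] [AddCommGroup N]
  [Module ℝ N] (P : RootPairing ι ℝ E N)

/-- The coroot `2r / ⟨r, r⟩` as a vector of the ambient inner product space. -/
noncomputable def innerCoroot (i : ι) : E := (2 / ⟪P.root i, P.root i⟫) • P.root i

theorem inner_root_self_pos (i : ι) : 0 < ⟪P.root i, P.root i⟫ :=
  real_inner_self_pos.2 (P.ne_zero i)

/-- An inner product is invariant under the Weyl group. -/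
def IsInvariantInner : Prop :=
  ∀ (i : ι) (x y : E), ⟪P.reflection i x, P.reflection i y⟫ = ⟪x, y⟫

variable {P}

/-- Invariance together with `s_r r = -r` forces the functional to be the pairing with `2r / ⟨r,
r⟩`. -/
theorem coroot'_eq_inner (hP : IsInvariantInner P) (i : ι) (x : E) :
    P.coroot' i x = ⟪innerCoroot P i, x⟫ := by
  have h := hP i x (P.root i)
  rw [P.reflection_apply_self, P.reflection_apply, inner_neg_right, inner_sub_left,
    real_inner_smul_left] at h
  have h0 := (inner_root_self_pos P i).ne'
  rw [innerCoroot, real_inner_smul_left, real_inner_comm]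
  field_simp
  rw [real_inner_comm (P.root i) x] at h
  linarith

theorem pairing_eq_inner (hP : IsInvariantInner P) (i j : ι) :
    P.pairing i j = ⟪innerCoroot P j, P.root i⟫ :=
  coroot'_eq_inner hP j (P.root i)

theorem inner_root_innerCoroot (i : ι) : ⟪P.root i, innerCoroot P i⟫ = 2 := by
  rw [innerCoroot, real_inner_smul_right, div_mul_cancel₀ _ (inner_root_self_pos P i).ne']

theorem reflection_apply_inner (hP : IsInvariantInner P) (i : ι) (x : E) :
    P.reflection i x = x - ⟪P.root i, x⟫ • innerCoroot P i := by
  rw [P.reflection_apply, coroot'_eq_inner hP, innerCoroot, real_inner_smul_left, smul_smul,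
    mul_comm]

theorem ofIdx_smul_eq (i : ι) (x : E) : weylGroup.ofIdx P i • x = P.reflection i x := rfl

theorem ofIdx_inv (i : ι) : (weylGroup.ofIdx P i)⁻¹ = weylGroup.ofIdx P i :=
  Subtype.ext (RootPairing.Equiv.reflection_inv P i)

/-- A root is never twice an element of the root lattice. -/
theorem root_ne_two_smul [Finite ι] [P.IsRootSystem] [P.IsCrystallographic] [P.IsReduced]
    (b : P.Base) (i : ι) {x : E} (hx : x ∈ Submodule.span ℤ (Set.range P.root)) :
    P.root i ≠ (2 : ℝ) • x := by
  classical
  have hrefl : ∀ (j : ι) {x : E}, x ∈ Submodule.span ℤ (Set.range P.root) →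
      P.reflection j x ∈ Submodule.span ℤ (Set.range P.root) := by
    intro j x hx
    induction hx using Submodule.span_induction with
    | mem x hx =>
      obtain ⟨k, rfl⟩ := hx
      rw [← P.root_reflectionPerm]
      exact Submodule.subset_span (Set.mem_range_self _)
    | zero => simp
    | add x y _ _ hx hy => rw [map_add]; exact add_mem hx hy
    | smul a x _ hx => rw [map_zsmul]; exact Submodule.smul_mem _ a hx
  have hstep : ∀ i j : ι, (∀ x ∈ Submodule.span ℤ (Set.range P.root), P.root i ≠ (2 : ℝ) • x) →
      ∀ x ∈ Submodule.span ℤ (Set.range P.root), P.root (P.reflectionPerm j i) ≠ (2 : ℝ) • x := by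
    intro i j h x hx h'
    refine h _ (hrefl j hx) ?_
    rw [← map_smul, ← h', P.root_reflectionPerm, P.reflection_same]
  -- The property is invariant under reflections, so it suffices to treat a simple root. Its own
  -- coordinate in the basis of simple roots is 1, whereas lattice vectors have integral coordinates
  -- and 1 is odd.
  refine b.induction_reflect i (p := fun i => ∀ x ∈ Submodule.span ℤ (Set.range P.root),
    P.root i ≠ (2 : ℝ) • x) (fun i h => hstep i i h) ?_ (fun i j h _ => hstep i j h) x hx
  intro i hi x hx h
  have hint : ∃ z : ℤ, b.toWeightBasis.repr x ⟨i, hi⟩ = z := by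
    clear h
    rw [← b.span_int_root_support] at hx
    induction hx using Submodule.span_induction with
    | mem x hx =>
      obtain ⟨k, hk, rfl⟩ := hx
      have := b.toWeightBasis_repr_root ⟨k, hk⟩
      simp only at this
      rw [this, Finsupp.single_apply]
      split_ifs
      exacts [⟨1, by simp⟩, ⟨0, by simp⟩]
    | zero => exact ⟨0, by simp⟩
    | add x y _ _ hx hy =>
      obtain ⟨a, ha⟩ := hx
      obtain ⟨b, hb⟩ := hy
      exact ⟨a + b, by simp [ha, hb]⟩
    | smul a x _ hx =>
      obtain ⟨b, hb⟩ := hx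
      exact ⟨a * b, by simp [hb]⟩
  obtain ⟨z, hz⟩ := hint
  have h1 := congrArg (fun y => b.toWeightBasis.repr y ⟨i, hi⟩) h
  have h2 := b.toWeightBasis_repr_root ⟨i, hi⟩
  simp only at h1 h2
  rw [h2, map_smul, Finsupp.smul_apply, hz, Finsupp.single_eq_same, smul_eq_mul] at h1
  have h3 : (1 : ℤ) = 2 * z := by exact_mod_cast h1
  lia

/-- The reflection subgroup generated by the reflections in a family of roots. -/
noncomputable def generatedSubgroup {κ : Type*} (f : κ → ι) : Subgroup P.weylGroup :=
  Subgroup.closure (Set.range fun j => weylGroup.ofIdx P (f j))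

/-- The group generated by the reflections in the roots `f j` acts trivially on the quotient of
the coweight lattice of these roots by their coroot lattice. -/
theorem smul_sub_mem_span_innerCoroot [P.IsCrystallographic] (hP : IsInvariantInner P)
    {κ : Type*} (f : κ → ι) {w : P.weylGroup} (hw : w ∈ generatedSubgroup (P := P) f) {x : E}
    (hx : ∀ j, ∃ z : ℤ, ⟪P.root (f j), x⟫ = z) :
    w • x - x ∈ Submodule.span ℤ (Set.range fun j => innerCoroot P (f j)) := by
  have hgen : ∀ k, ∀ x : E, (∀ j, ∃ z : ℤ, ⟪P.root (f j), x⟫ = z) →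
      weylGroup.ofIdx P (f k) • x - x ∈
        Submodule.span ℤ (Set.range fun j => innerCoroot P (f j)) := by
    intro k x hx
    obtain ⟨z, hz⟩ := hx k
    rw [ofIdx_smul_eq, reflection_apply_inner hP, hz, sub_sub_cancel_left,
      Int.cast_smul_eq_zsmul]
    exact neg_mem (Submodule.smul_mem _ _ (Submodule.subset_span ⟨k, rfl⟩))
  -- By crystallographicity the coroot lattice lies in the coweight lattice, so translating by it
  -- preserves the integrality hypothesis on `x`.
  have hlat : ∀ y ∈ Submodule.span ℤ (Set.range fun j => innerCoroot P (f j)),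
      ∀ j, ∃ z : ℤ, ⟪P.root (f j), y⟫ = z := by
    intro y hy j
    induction hy using Submodule.span_induction with
    | mem y hy =>
      obtain ⟨k, rfl⟩ := hy
      refine ⟨P.pairingIn ℤ (f j) (f k), ?_⟩
      have h1 : ((P.pairingIn ℤ (f j) (f k) : ℤ) : ℝ) = P.pairing (f j) (f k) :=
        P.algebraMap_pairingIn ℤ (f j) (f k)
      simp only
      rw [h1, pairing_eq_inner hP, real_inner_comm]
    | zero => exact ⟨0, by simp⟩
    | add x y _ _ hx hy =>
      obtain ⟨a, ha⟩ := hx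
      obtain ⟨b, hb⟩ := hy
      exact ⟨a + b, by rw [inner_add_right, ha, hb]; push_cast; rfl⟩
    | smul a x _ hx =>
      obtain ⟨b, hb⟩ := hx
      exact ⟨a * b, by
        rw [← Int.cast_smul_eq_zsmul ℝ, real_inner_smul_right, hb]; push_cast; rfl⟩
  unfold generatedSubgroup at hw
  revert x
  induction hw using Subgroup.closure_induction'' with
  | mem w hw =>
    obtain ⟨k, rfl⟩ := hw
    exact fun {x} hx => hgen k x hx
  | inv_mem w hw =>
    obtain ⟨k, rfl⟩ := hw
    intro x hx
    simp only [ofIdx_inv]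
    exact hgen k x hx
  | one => intro x _; simp
  | mul w₁ w₂ _ _ h₁ h₂ =>
    intro x hx
    have h3 : ∀ j, ∃ z : ℤ, ⟪P.root (f j), w₂ • x⟫ = z := by
      intro j
      obtain ⟨a, ha⟩ := hx j
      obtain ⟨b, hb⟩ := hlat _ (h₂ hx) j
      rw [inner_sub_right, ha] at hb
      exact ⟨a + b, by push_cast; linarith⟩
    have := add_mem (h₁ h3) (h₂ hx)
    rwa [sub_add_sub_cancel, ← mul_smul] at this

/-- If the roots `f j` form a basis, then the coroot of every reflection in the group generated by
the corresponding reflections is an integral combination of the coroots of the `f j`. -/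
theorem innerCoroot_mem_span [FiniteDimensional ℝ E] [Finite ι] [P.IsRootSystem]
    [P.IsCrystallographic] [P.IsReduced] (hP : IsInvariantInner P) (b : P.Base)
    {κ : Type*} [Fintype κ] [DecidableEq κ] (f : κ → ι) (B : Module.Basis κ ℝ E)
    (hB : ∀ j, B j = P.root (f j)) {i : ι}
    (hi : weylGroup.ofIdx P i ∈ generatedSubgroup (P := P) f) :
    innerCoroot P i ∈ Submodule.span ℤ (Set.range fun j => innerCoroot P (f j)) := by
  set t : ι → ℝ := fun i => 2 / ⟪P.root i, P.root i⟫ with ht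
  have htpos : ∀ i, 0 < t i := fun i => div_pos two_pos (inner_root_self_pos P i)
  set c : κ → ℝ := fun k => B.repr (P.root i) k with hc
  have hrc : P.root i = ∑ k, c k • P.root (f k) := by
    simp_rw [← hB]; exact (B.sum_repr _).symm
  set d : κ → ℝ := fun k => t i * c k / t (f k) with hd
  have hrd : innerCoroot P i = ∑ k, d k • innerCoroot P (f k) := by
    change t i • P.root i = ∑ k, d k • t (f k) • P.root (f k)
    rw [hrc, Finset.smul_sum]
    refine Finset.sum_congr rfl fun k _ => ?_
    rw [smul_smul, smul_smul, hd, div_mul_cancel₀ _ (htpos _).ne']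
  have hint : ∀ {y : E}, y ∈ Submodule.span ℤ (Set.range fun j => innerCoroot P (f j)) →
      ∀ {e : κ → ℝ}, y = ∑ k, e k • innerCoroot P (f k) → ∀ k, ∃ z : ℤ, e k = z := by
    intro y hy e he k
    obtain ⟨g, hg⟩ := (Submodule.mem_span_range_iff_exists_fun ℤ).1 hy
    refine ⟨g k, ?_⟩
    have h1 : ∑ k, (e k * t (f k)) • B k = ∑ k, ((g k : ℝ) * t (f k)) • B k := by
      trans y
      · rw [he]
        refine Finset.sum_congr rfl fun k _ => ?_
        rw [hB, mul_smul]; rfl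
      · rw [← hg]
        refine Finset.sum_congr rfl fun k _ => ?_
        rw [hB, mul_smul, Int.cast_smul_eq_zsmul]; rfl
    have h2 := congrArg (fun y => B.repr y k) h1
    simp only [B.repr_sum_self] at h2
    exact mul_right_cancel₀ (htpos _).ne' h2
  -- Apply `s_i - 1` to the fundamental coweight `ω` dual to `f k`: the result is `-c k` times the
  -- coroot of `i`, and it lies in the lattice by the trivial action.
  have hcr : ∀ k, c k • innerCoroot P i ∈
      Submodule.span ℤ (Set.range fun j => innerCoroot P (f j)) := by
    intro k
    set ω : E := (InnerProductSpace.toDual ℝ E).symm (LinearMap.toContinuousLinearMap (B.coord k))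
      with hω
    have hωx : ∀ x, ⟪ω, x⟫ = B.repr x k := fun x => by
      rw [hω, InnerProductSpace.toDual_symm_apply]; rfl
    have hω1 : ∀ j, ∃ z : ℤ, ⟪P.root (f j), ω⟫ = z := by
      intro j
      rw [real_inner_comm, hωx, ← hB, B.repr_self, Finsupp.single_apply]
      split_ifs
      exacts [⟨1, by simp⟩, ⟨0, by simp⟩]
    have := smul_sub_mem_span_innerCoroot hP f hi hω1
    rw [ofIdx_smul_eq, reflection_apply_inner hP, real_inner_comm, hωx, sub_sub_cancel_left] at this
    exact neg_mem_iff.1 this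
  have hcd : ∀ k j, ∃ z : ℤ, c k * d j = z := by
    intro k j
    refine hint (hcr k) (e := fun j => c k * d j) ?_ j
    rw [hrd, Finset.smul_sum]
    simp_rw [mul_smul]
  have hpair : ∀ i j, ∃ z : ℤ, ⟪P.root i, innerCoroot P j⟫ = z := fun i j =>
    ⟨P.pairingIn ℤ i j, by
      rw [real_inner_comm, ← pairing_eq_inner hP]; exact (P.algebraMap_pairingIn ℤ i j).symm⟩
  -- Expand `2 = ⟨root i, coroot i⟩` in the coordinates `c` and multiply by `d j`: the products `c k
  -- * d j` and the pairings are integers. The same with `d` expanded bounds the denominators of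
  -- `c`.
  have h2d : ∀ j, ∃ z : ℤ, 2 * d j = z := by
    intro j
    choose m hm using fun k => hpair (f k) i
    choose z hz using fun k => hcd k j
    refine ⟨∑ k, z k * m k, ?_⟩
    rw [← inner_root_innerCoroot (P := P) i]
    nth_rw 1 [hrc]
    rw [sum_inner, Finset.sum_mul]
    push_cast
    refine Finset.sum_congr rfl fun k _ => ?_
    rw [real_inner_smul_left, hm, ← hz]
    ring
  have h2c : ∀ k, ∃ z : ℤ, 2 * c k = z := by
    intro k
    choose m hm using fun j => hpair i (f j)
    choose z hz using fun j => hcd k j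
    refine ⟨∑ j, z j * m j, ?_⟩
    rw [← inner_root_innerCoroot (P := P) i, hrd, inner_sum, Finset.sum_mul]
    push_cast
    refine Finset.sum_congr rfl fun j _ => ?_
    rw [real_inner_smul_right, hm, ← hz]
    ring
  have hdint : ∀ j, ∃ z : ℤ, d j = z := by
    intro j
    obtain ⟨m, hm⟩ := h2d j
    rcases Int.even_or_odd' m with ⟨q, rfl | rfl⟩
    · exact ⟨q, by push_cast at hm; linarith⟩
    exfalso
    -- If `2 * d j = 2q + 1` is odd, then `a * (2q + 1) = 4z` makes `a = 2 * c k` divisible by 4;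
    -- the multiplier `1 - 2q` inverts `2q + 1` modulo 4. All `c k` are then even, so the root would
    -- be twice a vector of the root lattice.
    have hceven : ∀ k, ∃ z : ℤ, c k = 2 * z := by
      intro k
      obtain ⟨a, ha⟩ := h2c k
      obtain ⟨z, hz⟩ := hcd k j
      have h4 : a * (2 * q + 1) = 4 * z := by
        have : (a : ℝ) * ((2 * q + 1 : ℤ) : ℝ) = 4 * z := by rw [← ha, ← hm, ← hz]; ring
        exact_mod_cast this
      have hr : a = 4 * (z - q * (2 * z - q * a)) := by linear_combination (1 - 2 * q) * h4
      refine ⟨z - q * (2 * z - q * a), ?_⟩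
      have : (a : ℝ) = 4 * ((z - q * (2 * z - q * a) : ℤ) : ℝ) := by exact_mod_cast hr
      linarith
    choose z hz using hceven
    refine root_ne_two_smul b i (x := ∑ k, z k • P.root (f k)) ?_ ?_
    · exact Submodule.sum_mem _ fun k _ => Submodule.smul_mem _ _
        (Submodule.subset_span (Set.mem_range_self _))
    · rw [hrc, Finset.smul_sum]
      refine Finset.sum_congr rfl fun k _ => ?_
      rw [hz, mul_smul, Int.cast_smul_eq_zsmul]
  choose z hz using hdint
  rw [hrd]
  refine Submodule.sum_mem _ fun k _ => ?_
  rw [hz, Int.cast_smul_eq_zsmul]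
  exact Submodule.smul_mem _ _ (Submodule.subset_span ⟨k, rfl⟩)

end RootLattice

/-! ### The Laplacian of a set of roots -/

section Laplacian

variable {ι E N : Type*} [NormedAddCommGroup E] [InnerProductSpace ℝ E] [AddCommGroup N]
  [Module ℝ N]

/-- The Laplacian `∑ i ∈ C, (1 - s_i)` of a finite set of roots. -/
noncomputable def laplacian (P : RootPairing ι ℝ E N) (C : Finset ι) : E →ₗ[ℝ] E :=
  ∑ i ∈ C, (innerₗ E (innerCoroot P i)).smulRight (P.root i)

variable {P : RootPairing ι ℝ E N}

theorem laplacian_apply (C : Finset ι) (x : E) :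
    laplacian P C x = ∑ i ∈ C, ⟪innerCoroot P i, x⟫ • P.root i := by
  simp [laplacian, LinearMap.sum_apply]

theorem inner_laplacian_left (C : Finset ι) (x y : E) :
    ⟪laplacian P C x, y⟫ = ⟪x, laplacian P C y⟫ := by
  rw [laplacian_apply, laplacian_apply, sum_inner, inner_sum]
  refine Finset.sum_congr rfl fun i _ => ?_
  rw [real_inner_smul_left, real_inner_smul_right, innerCoroot, real_inner_smul_left,
    real_inner_smul_left, real_inner_comm x]
  ring

theorem inner_innerCoroot_reflectionPerm (hP : IsInvariantInner P) (i j : ι) (x : E) :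
    ⟪innerCoroot P (P.reflectionPerm j i), P.reflection j x⟫ = ⟪innerCoroot P i, x⟫ := by
  rw [← coroot'_eq_inner hP, ← coroot'_eq_inner hP, P.coroot'_reflection,
    P.reflectionPerm_self]

theorem laplacian_reflection (hP : IsInvariantInner P) {C : Finset ι} {j : ι}
    (hC : ∀ i ∈ C, P.reflectionPerm j i ∈ C) (x : E) :
    laplacian P C (P.reflection j x) = P.reflection j (laplacian P C x) := by
  rw [laplacian_apply, laplacian_apply, map_sum]
  symm
  refine Finset.sum_nbij' (P.reflectionPerm j) (P.reflectionPerm j) hC hC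
    (fun _ _ => P.reflectionPerm_self _ _) (fun _ _ => P.reflectionPerm_self _ _) fun i _ => ?_
  rw [inner_innerCoroot_reflectionPerm hP, map_smul, P.root_reflectionPerm]

/-- A root is an eigenvector of any Laplacian which commutes with its reflection. -/
theorem exists_laplacian_root (hP : IsInvariantInner P) {C : Finset ι} {j : ι}
    (hC : ∀ i ∈ C, P.reflectionPerm j i ∈ C) :
    ∃ a : ℝ, laplacian P C (P.root j) = a • P.root j := by
  -- The image of the root is negated by `s_j`, and a vector negated by `s_j` is a multiple of the
  -- root `j`.
  have h := laplacian_reflection hP hC (P.root j)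
  rw [P.reflection_apply_self, map_neg, P.reflection_apply] at h
  refine ⟨(1 / 2 : ℝ) * P.coroot' j (laplacian P C (P.root j)), ?_⟩
  have h2 : (2 : ℝ) • laplacian P C (P.root j) =
      P.coroot' j (laplacian P C (P.root j)) • P.root j := by
    rw [two_smul]
    nth_rw 1 [← neg_neg (laplacian P C (P.root j)), h]
    abel
  rw [mul_smul, ← h2, smul_smul]
  norm_num

/-- The Laplacian is self-adjoint, so eigenvectors with distinct eigenvalues are orthogonal. -/
theorem eigenvalue_eq_of_pairing_ne_zero (hP : IsInvariantInner P) {C : Finset ι} {i j : ι}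
    {a c : ℝ} (ha : laplacian P C (P.root i) = a • P.root i)
    (hc : laplacian P C (P.root j) = c • P.root j) (hij : P.pairing i j ≠ 0) : a = c := by
  have h := inner_laplacian_left (P := P) C (P.root i) (P.root j)
  rw [ha, hc, real_inner_smul_left, real_inner_smul_right] at h
  refine mul_right_cancel₀ (fun h0 => hij ?_) h
  rw [pairing_eq_inner hP, innerCoroot, real_inner_smul_left,
    real_inner_comm (P.root i), h0, mul_zero]

theorem trace_laplacian [FiniteDimensional ℝ E] (C : Finset ι) :
    LinearMap.trace ℝ E (laplacian P C) = 2 * C.card := by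
  rw [laplacian, map_sum, Finset.sum_congr rfl fun i _ => ?_, Finset.sum_const, nsmul_eq_mul,
    mul_comm]
  rw [LinearMap.trace_smulRight]
  change ⟪innerCoroot P i, P.root i⟫ = 2
  rw [real_inner_comm, inner_root_innerCoroot]

theorem trace_eq_sum_of_basis {κ : Type*} [Fintype κ] [DecidableEq κ] (B : Module.Basis κ ℝ E)
    (L : E →ₗ[ℝ] E) (a : κ → ℝ) (h : ∀ k, L (B k) = a k • B k) :
    LinearMap.trace ℝ E L = ∑ k, a k := by
  rw [LinearMap.trace_eq_matrix_trace ℝ B, Matrix.trace]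
  refine Finset.sum_congr rfl fun k _ => ?_
  simp [LinearMap.toMatrix_apply, h]

theorem det_eq_prod_of_basis {κ : Type*} [Fintype κ] [DecidableEq κ] (B : Module.Basis κ ℝ E)
    (L : E →ₗ[ℝ] E) (a : κ → ℝ) (h : ∀ k, L (B k) = a k • B k) :
    LinearMap.det L = ∏ k, a k := by
  rw [← LinearMap.det_toMatrix B]
  have : LinearMap.toMatrix B B L = Matrix.diagonal a := by
    ext i j
    rw [LinearMap.toMatrix_apply, h, map_smul, Module.Basis.repr_self, Finsupp.smul_apply,
      Finsupp.single_apply, Matrix.diagonal_apply]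
    by_cases hij : i = j
    · simp [hij]
    · simp [hij, Ne.symm hij]
  rw [this, Matrix.det_diagonal]

end Laplacian

/-! ### Positive roots and reflections -/

section PositiveRoots

variable {ι E N : Type*} [NormedAddCommGroup E] [InnerProductSpace ℝ E] [AddCommGroup N]
  [Module ℝ N] {P : RootPairing ι ℝ E N}

theorem isPos_reflectionPerm_self_iff [Finite ι] [P.IsRootSystem] [P.IsCrystallographic]
    [P.IsReduced] (b : P.Base) (i : ι) : b.IsPos (P.reflectionPerm i i) ↔ ¬ b.IsPos i :=
  RootPairing.Base.IsPos.neg_iff_not b i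

-- Negation `r ↦ -r` exchanges the positive and the negative members of `C`.
open scoped Classical in
theorem sum_eq_two_smul_sum_isPos [Finite ι] [P.IsRootSystem] [P.IsCrystallographic]
    [P.IsReduced] (b : P.Base) {M : Type*} [AddCommMonoid M] {C : Finset ι}
    (hC : ∀ i ∈ C, P.reflectionPerm i i ∈ C) (F : ι → M)
    (hF : ∀ i, F (P.reflectionPerm i i) = F i) :
    ∑ i ∈ C, F i = 2 • ∑ i ∈ C with b.IsPos i, F i := by
  let := P.indexNeg
  have hneg : ∀ i : ι, P.reflectionPerm (P.reflectionPerm i i) (P.reflectionPerm i i) = i :=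
    fun i => neg_neg i
  rw [two_smul, ← Finset.sum_filter_add_sum_filter_not C b.IsPos]
  congr 1
  refine Finset.sum_nbij' (fun i => P.reflectionPerm i i) (fun i => P.reflectionPerm i i)
    ?_ ?_ (fun i _ => hneg i) (fun i _ => hneg i) fun i _ => (hF i).symm
  · intro i hi
    rw [Finset.mem_filter] at hi ⊢
    exact ⟨hC i hi.1, (isPos_reflectionPerm_self_iff b i).2 hi.2⟩
  · intro i hi
    rw [Finset.mem_filter] at hi ⊢
    exact ⟨hC i hi.1, fun h => (isPos_reflectionPerm_self_iff b i).1 h hi.2⟩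

theorem eq_or_eq_reflectionPerm_of_ofIdx_eq [P.IsReduced] {i j : ι}
    (h : weylGroup.ofIdx P i = weylGroup.ofIdx P j) : i = j ∨ i = P.reflectionPerm j j := by
  have h1 : P.reflection i (P.root i) = P.reflection j (P.root i) := by
    rw [← ofIdx_smul_eq, h, ofIdx_smul_eq]
  rw [P.reflection_apply_self, P.reflection_apply] at h1
  -- Evaluating both reflections at the root `i` gives `2 r_i = c r_j`, so the two roots are
  -- proportional, and reducedness applies.
  have hli : ¬ LinearIndependent ℝ ![P.root i, P.root j] := by
    rw [LinearIndependent.pair_iff]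
    intro h2
    have := (h2 2 (-P.coroot' j (P.root i)) ?_).1
    · norm_num at this
    · rw [two_smul, neg_smul]
      nth_rw 1 [← neg_neg (P.root i), h1]
      abel
  exact (RootPairing.IsReduced.eq_or_eq_neg (P := P) i j hli).imp (fun h => P.root.injective h)
    P.root_eq_neg_iff.1

theorem ofIdx_reflectionPerm (i j : ι) : weylGroup.ofIdx P (P.reflectionPerm j i) =
    weylGroup.ofIdx P j * weylGroup.ofIdx P i * weylGroup.ofIdx P j := by
  apply Subtype.ext
  apply RootPairing.Equiv.weightHom_injective P
  simp only [Subgroup.coe_mul, map_mul, weylGroup.ofIdx, RootPairing.Equiv.weightHom_apply,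
    RootPairing.Equiv.reflection_weightEquiv]
  exact P.reflection_reflectionPerm

theorem reflectionPerm_mem_rootIndices {H : Subgroup P.weylGroup} {i j : ι}
    (hi : i ∈ rootIndices P H) (hj : j ∈ rootIndices P H) :
    P.reflectionPerm j i ∈ rootIndices P H := by
  change weylGroup.ofIdx P _ ∈ H
  rw [ofIdx_reflectionPerm]
  exact mul_mem (mul_mem hj hi) hj

theorem innerCoroot_reflectionPerm_self (i : ι) :
    innerCoroot P (P.reflectionPerm i i) = -innerCoroot P i := by
  rw [innerCoroot, P.root_reflectionPerm, P.reflection_apply_self, inner_neg_neg, smul_neg,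
    innerCoroot]

open scoped Classical in
theorem laplacian_eq_two_smul [Finite ι] [P.IsRootSystem] [P.IsCrystallographic]
    [P.IsReduced] (b : P.Base) {C : Finset ι} (hC : ∀ i ∈ C, P.reflectionPerm i i ∈ C) :
    laplacian P C = (2 : ℝ) • laplacian P {i ∈ C | b.IsPos i} := by
  rw [laplacian, sum_eq_two_smul_sum_isPos b hC, two_smul, two_smul, laplacian]
  intro i
  ext x
  simp [innerCoroot_reflectionPerm_self, P.root_reflectionPerm]

/-- A finite symmetric set of roots has twice as many elements as reflections. -/
theorem card_eq_two_mul_ncard [Finite ι] [P.IsRootSystem] [P.IsCrystallographic]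
    [P.IsReduced] (b : P.Base) {C : Finset ι} (hC : ∀ i ∈ C, P.reflectionPerm i i ∈ C) :
    C.card = 2 * (weylGroup.ofIdx P '' (C : Set ι)).ncard := by
  classical
  have h1 : weylGroup.ofIdx P '' (C : Set ι) =
      weylGroup.ofIdx P '' (({i ∈ C | b.IsPos i} : Finset ι) : Set ι) := by
    refine subset_antisymm ?_ (Set.image_mono (Finset.coe_subset.2 (Finset.filter_subset _ _)))
    rintro _ ⟨i, hi, rfl⟩
    by_cases h : b.IsPos i
    · exact ⟨i, by simpa using ⟨hi, h⟩, rfl⟩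
    · refine ⟨P.reflectionPerm i i, ?_, ?_⟩
      · simpa using ⟨hC i hi, (isPos_reflectionPerm_self_iff b i).2 h⟩
      · rw [ofIdx_reflectionPerm, mul_assoc]
        nth_rw 2 [← ofIdx_inv]
        rw [inv_mul_cancel, mul_one]
  rw [h1, Set.InjOn.ncard_image, Set.ncard_coe_finset, Finset.card_eq_sum_ones,
    sum_eq_two_smul_sum_isPos b hC _ fun _ => rfl, Finset.card_eq_sum_ones, smul_eq_mul]
  intro i hi j hj h
  rw [Finset.mem_coe, Finset.mem_filter] at hi hj
  refine (eq_or_eq_reflectionPerm_of_ofIdx_eq h).resolve_right fun h' => ?_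
  exact (isPos_reflectionPerm_self_iff b j).1 (h' ▸ hi.2) hj.2

end PositiveRoots

/-! ### Irreducible components and Coxeter numbers -/

section Components

variable {ι E N : Type*} [NormedAddCommGroup E] [InnerProductSpace ℝ E] [AddCommGroup N]
  [Module ℝ N] {P : RootPairing ι ℝ E N} {H : Subgroup P.weylGroup}

theorem mem_componentRoots {c : (nonOrthogonalityGraph P H).ConnectedComponent} {i : ι} :
    i ∈ componentRoots P H c ↔
      ∃ h : i ∈ rootIndices P H, (nonOrthogonalityGraph P H).connectedComponentMk ⟨i, h⟩ = c := by
  simp [componentRoots, SimpleGraph.ConnectedComponent.mem_supp_iff]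

theorem componentRoots_subset (c : (nonOrthogonalityGraph P H).ConnectedComponent) :
    componentRoots P H c ⊆ rootIndices P H :=
  fun _ hi => (mem_componentRoots.1 hi).1

theorem mem_componentRoots_of_pairing_ne_zero
    {c : (nonOrthogonalityGraph P H).ConnectedComponent} {i j : ι} (hi : i ∈ componentRoots P H c)
    (hj : j ∈ rootIndices P H) (hij : P.pairing i j ≠ 0) : j ∈ componentRoots P H c := by
  obtain ⟨hi', rfl⟩ := mem_componentRoots.1 hi
  refine mem_componentRoots.2 ⟨hj, ?_⟩
  by_cases h : i = j
  · subst h; rfl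
  · refine SimpleGraph.ConnectedComponent.eq.2 (SimpleGraph.Adj.reachable ?_)
    rw [nonOrthogonalityGraph, SimpleGraph.fromRel_adj]
    exact ⟨fun h' => h (congrArg Subtype.val h').symm, Or.inr hij⟩

theorem reflectionPerm_self_mem_componentRoots
    {c : (nonOrthogonalityGraph P H).ConnectedComponent} {i : ι} (hi : i ∈ componentRoots P H c) :
    P.reflectionPerm i i ∈ componentRoots P H c := by
  have hi' := componentRoots_subset c hi
  refine mem_componentRoots_of_pairing_ne_zero hi (reflectionPerm_mem_rootIndices hi' hi') ?_
  rw [P.pairing_reflectionPerm_self_right, P.pairing_same]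
  norm_num

theorem inner_root_eq_zero_of_notMem_component (hP : IsInvariantInner P)
    {c : (nonOrthogonalityGraph P H).ConnectedComponent} {i j : ι} (hi : i ∈ componentRoots P H c)
    (hj : j ∈ rootIndices P H) (hj' : j ∉ componentRoots P H c) :
    ⟪P.root i, P.root j⟫ = 0 := by
  by_contra h
  refine hj' (mem_componentRoots_of_pairing_ne_zero hi hj fun h0 => h ?_)
  rw [pairing_eq_inner hP, innerCoroot, real_inner_smul_left,
    real_inner_comm (P.root i)] at h0
  exact (mul_eq_zero.1 h0).resolve_left (div_pos two_pos (inner_root_self_pos P j)).ne'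

/-- A basis of the ambient space consisting of roots meets each component in a basis of its span. -/
theorem rootRank_componentRoots (hP : IsInvariantInner P) [FiniteDimensional ℝ E]
    {K : Set ι} [Finite K] (hK : K ⊆ rootIndices P H) (hli : LinearIndepOn ℝ P.root K)
    (hspan : rootIndices P H ⊆ P.root ⁻¹' (Submodule.span ℝ (P.root '' K) : Set E))
    (c : (nonOrthogonalityGraph P H).ConnectedComponent) :
    rootRank P (componentRoots P H c) = (K ∩ componentRoots P H c).ncard := by
  have hsub : Submodule.span ℝ (P.root '' componentRoots P H c) =
      Submodule.span ℝ (P.root '' (K ∩ componentRoots P H c)) := by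
    refine le_antisymm ?_ (Submodule.span_mono (Set.image_mono Set.inter_subset_right))
    rw [Submodule.span_le]
    rintro _ ⟨i, hi, rfl⟩
    -- Split the root as `y + z`, with `y` from the basis roots inside the component and `z` from
    -- those outside. Then `z` is orthogonal to the span of the component and also lies in it, so `z
    -- = 0`.
    have h1 : P.root i ∈ Submodule.span ℝ (P.root '' K) := hspan (componentRoots_subset c hi)
    rw [← Set.inter_union_sdiff K (componentRoots P H c), Set.image_union, Submodule.span_union,
      Submodule.mem_sup] at h1
    obtain ⟨y, hy, z, hz, hyz⟩ := h1
    have horth : ∀ x ∈ Submodule.span ℝ (P.root '' componentRoots P H c), ⟪x, z⟫ = 0 := by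
      intro x hx
      refine Submodule.span_induction (p := fun z _ => ⟪x, z⟫ = 0) ?_ (by simp)
        (fun a b _ _ ha hb => by rw [inner_add_right, ha, hb, add_zero])
        (fun t a _ ha => by rw [real_inner_smul_right, ha, mul_zero]) hz
      rintro _ ⟨j, hj, rfl⟩
      refine Submodule.span_induction (p := fun x _ => ⟪x, P.root j⟫ = 0) ?_ (by simp)
        (fun a b _ _ ha hb => by rw [inner_add_left, ha, hb, add_zero])
        (fun t a _ ha => by rw [real_inner_smul_left, ha, mul_zero]) hx
      rintro _ ⟨k, hk, rfl⟩
      exact inner_root_eq_zero_of_notMem_component hP hk (hK hj.1) hj.2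
    have hzc : z ∈ Submodule.span ℝ (P.root '' componentRoots P H c) := by
      rw [← add_sub_cancel_left y z, hyz]
      exact sub_mem (Submodule.subset_span ⟨i, hi, rfl⟩)
        (Submodule.span_mono (Set.image_mono Set.inter_subset_right) hy)
    have hz0 : z = 0 := inner_self_eq_zero.1 (horth z hzc)
    rw [← hyz, hz0, add_zero]
    exact hy
  have hli' : LinearIndepOn ℝ P.root (K ∩ componentRoots P H c) := hli.mono Set.inter_subset_left
  have : Fintype ↑(K ∩ componentRoots P H c) := Fintype.ofFinite _
  rw [rootRank, hsub, Set.image_eq_range, finrank_span_eq_card hli',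
    ← Nat.card_eq_fintype_card, Nat.card_coe_set_eq]

/-- The determinant of the Laplacian of a reflection subgroup of maximal rank is the product of its
Coxeter numbers. -/
theorem det_laplacian [Finite ι] [FiniteDimensional ℝ E] [P.IsRootSystem] [P.IsCrystallographic]
    [P.IsReduced] (hP : IsInvariantInner P) (b : P.Base)
    (hH : rootRank P (rootIndices P H) = Module.finrank ℝ E) {S : Finset ι}
    (hS : ∀ i, i ∈ S ↔ i ∈ rootIndices P H ∧ b.IsPos i) :
    LinearMap.det (laplacian P S) = (coxeterNumbers P H).prod := by
  classical
  have : Fintype ι := Fintype.ofFinite ι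
  let : Fintype (nonOrthogonalityGraph P H).ConnectedComponent :=
    @Fintype.ofFinite _ (Quot.finite _)
  set T : Finset ι := {i | i ∈ rootIndices P H} with hT
  have hTmem : ∀ {i}, i ∈ T ↔ i ∈ rootIndices P H := by simp [hT]
  have hTS : S = {i ∈ T | b.IsPos i} := by
    ext i
    rw [hS, Finset.mem_filter, hTmem]
  have hTrefl : ∀ j ∈ T, ∀ i ∈ T, P.reflectionPerm j i ∈ T := fun j hj i hi =>
    hTmem.2 (reflectionPerm_mem_rootIndices (hTmem.1 hi) (hTmem.1 hj))
  have hL : laplacian P T = (2 : ℝ) • laplacian P S := by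
    rw [hTS]
    exact laplacian_eq_two_smul b fun i hi => hTrefl i hi i hi
  -- A basis of `E` made of roots of `H`: it diagonalizes the Laplacian.
  obtain ⟨K, hKT, -, hspan, hli⟩ := exists_linearIndepOn_extension (K := ℝ) (v := P.root)
    (linearIndepOn_empty ℝ P.root) (Set.empty_subset (rootIndices P H))
  have htop : ⊤ ≤ Submodule.span ℝ (Set.range fun k : K => P.root k) := by
    rw [← Set.image_eq_range, ← Submodule.eq_top_of_finrank_eq hH, Submodule.span_le]
    exact hspan
  let B : Module.Basis K ℝ E := Module.Basis.mk hli htop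
  have hB : ∀ k : K, B k = P.root k := fun k => Module.Basis.mk_apply hli htop k
  have hexists : ∀ i, ∃ a : ℝ, i ∈ T → laplacian P T (P.root i) = a • P.root i := by
    intro i
    by_cases hi : i ∈ T
    · obtain ⟨a, ha⟩ := exists_laplacian_root hP (hTrefl i hi)
      exact ⟨a, fun _ => ha⟩
    · exact ⟨0, fun h => absurd h hi⟩
  choose a ha using hexists
  have hreach : ∀ i j : rootIndices P H, (nonOrthogonalityGraph P H).Reachable i j →
      a i = a j := by
    rintro i j ⟨w⟩
    induction w with
    | nil => rfl
    | @cons i k j hik _ ih =>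
      rw [← ih]
      rw [nonOrthogonalityGraph, SimpleGraph.fromRel_adj] at hik
      rcases hik.2 with h | h
      · exact eigenvalue_eq_of_pairing_ne_zero hP (ha _ (hTmem.2 i.2)) (ha _ (hTmem.2 k.2)) h
      · exact (eigenvalue_eq_of_pairing_ne_zero hP (ha _ (hTmem.2 k.2)) (ha _ (hTmem.2 i.2)) h).symm
  have hconst : ∀ {c} {i j}, i ∈ componentRoots P H c → j ∈ componentRoots P H c → a i = a j := by
    intro c i j hi hj
    obtain ⟨hi', h1⟩ := mem_componentRoots.1 hi
    obtain ⟨hj', h2⟩ := mem_componentRoots.1 hj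
    exact hreach ⟨i, hi'⟩ ⟨j, hj'⟩ (SimpleGraph.ConnectedComponent.eq.1 (h1.trans h2.symm))
  -- The Laplacian of one component acts as `a i` on its own roots and as 0 on the others. Comparing
  -- traces gives `a i * rank = 2 * |C| = 4N`, so `a i = 2h`; the extra 2 arises because `T`
  -- contains both `r` and `-r`.
  have hval : ∀ c, ∀ i ∈ componentRoots P H c,
      a i = 2 * coxeterNumber P (componentRoots P H c) := by
    intro c i hi
    set C : Finset ι := {i | i ∈ componentRoots P H c} with hC
    have hCmem : ∀ {i}, i ∈ C ↔ i ∈ componentRoots P H c := by simp [hC]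
    have hcoe : (C : Set ι) = componentRoots P H c := by ext; simp [hC]
    have heig : ∀ k : K, laplacian P C (B k) =
        (if (k : ι) ∈ componentRoots P H c then a i else 0) • B k := by
      intro k
      have hkT : (k : ι) ∈ T := hTmem.2 (hKT k.2)
      rw [hB, laplacian_apply]
      split_ifs with hk
      · rw [hconst hi hk, ← ha k hkT, laplacian_apply]
        refine Finset.sum_subset (fun j hj => hTmem.2 (componentRoots_subset c (hCmem.1 hj)))
          fun j hj hj' => ?_
        rw [innerCoroot, real_inner_smul_left, real_inner_comm (P.root k),
          inner_root_eq_zero_of_notMem_component hP hk (hTmem.1 hj) fun h => hj' (hCmem.2 h),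
          mul_zero, zero_smul]
      · rw [zero_smul]
        refine Finset.sum_eq_zero fun j hj => ?_
        rw [innerCoroot, real_inner_smul_left,
          inner_root_eq_zero_of_notMem_component hP (hCmem.1 hj) (hTmem.1 hkT) hk,
          mul_zero, zero_smul]
    have htr := trace_eq_sum_of_basis B _ _ heig
    have hcard : (Finset.univ.filter fun k : K => (k : ι) ∈ componentRoots P H c).card =
        (K ∩ componentRoots P H c).ncard := by
      rw [← Set.ncard_coe_finset, ← Set.InjOn.ncard_image Subtype.val_injective.injOn]
      congr 1
      ext; simp [and_comm]
    rw [trace_laplacian, ← Finset.sum_filter, Finset.sum_const, nsmul_eq_mul, hcard,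
      ← rootRank_componentRoots hP hKT hli (Set.image_subset_iff.1 hspan), card_eq_two_mul_ncard b fun i hi =>
        hCmem.2 (reflectionPerm_self_mem_componentRoots (hCmem.1 hi)), hcoe] at htr
    have hN : (weylGroup.ofIdx P '' componentRoots P H c).ncard ≠ 0 := by
      exact ((Set.ncard_pos (Set.toFinite _)).2 (Set.Nonempty.image _ ⟨i, hi⟩)).ne'
    push_cast at htr
    -- A zero rank would force `N = 0` in the trace identity, so the division defining the Coxeter
    -- number is genuine.
    have hr : (rootRank P (componentRoots P H c) : ℝ) ≠ 0 := by
      intro h0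
      rw [h0, zero_mul] at htr
      exact hN (by exact_mod_cast (by linarith :
        ((weylGroup.ofIdx P '' componentRoots P H c).ncard : ℝ) = 0))
    rw [coxeterNumber]
    field_simp
    linarith
  let comp : K → (nonOrthogonalityGraph P H).ConnectedComponent := fun k =>
    (nonOrthogonalityGraph P H).connectedComponentMk ⟨k, hKT k.2⟩
  have hcomp : ∀ (k : K) c, comp k = c ↔ (k : ι) ∈ componentRoots P H c := fun k c =>
    ⟨fun h => mem_componentRoots.2 ⟨hKT k.2, h⟩, fun h => (mem_componentRoots.1 h).2⟩
  have hdet : ∀ k : K, laplacian P S (B k) =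
      coxeterNumber P (componentRoots P H (comp k)) • B k := by
    intro k
    have h1 := ha k (hTmem.2 (hKT k.2))
    rw [hval (comp k) k ((hcomp k _).1 rfl), hL, mul_smul, LinearMap.smul_apply] at h1
    rw [hB]
    exact smul_right_injective E (two_ne_zero : (2 : ℝ) ≠ 0) h1
  rw [det_eq_prod_of_basis B _ _ hdet, coxeterNumbers, Multiset.prod_sum,
    ← Finset.prod_fiberwise_of_maps_to (t := Finset.univ) (g := comp) fun _ _ => Finset.mem_univ _]
  refine Finset.prod_congr rfl fun c _ => ?_
  rw [Multiset.prod_replicate, rootRank_componentRoots hP hKT hli (Set.image_subset_iff.1 hspan),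
    Finset.prod_congr rfl fun k hk => by rw [(Finset.mem_filter.1 hk).2], Finset.prod_const]
  congr 1
  rw [← Set.ncard_coe_finset, ← Set.InjOn.ncard_image Subtype.val_injective.injOn]
  congr 1
  ext i
  simp [hcomp, and_comm]

end Components

/-! ### Möbius inversion -/

section MoebiusInversion

theorem sum_moebius_toDual {α : Type*} [PartialOrder α] [Fintype α] [DecidableEq α]
    [DecidableLE α] (a b : α) :
    ∑ y : α with b ≤ y ∧ y ≤ a, moebius (toDual a) (toDual y) = if a = b then 1 else 0 := by
  classical
  let : Fintype αᵒᵈ := Fintype.ofFinite αᵒᵈ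
  let : LocallyFiniteOrder αᵒᵈ := Fintype.toLocallyFiniteOrder
  have h := IncidenceAlgebra.sum_Icc_mu_right (𝕜 := ℤ) (toDual a) (toDual b)
  have h2 : (if toDual a = toDual b then (1 : ℤ) else 0) = if a = b then 1 else 0 := by
    simp only [toDual_inj]
  rw [← h2, ← h]
  refine Finset.sum_nbij' toDual ofDual ?_ ?_ (fun _ _ => rfl) (fun _ _ => rfl) ?_
  · intro y hy
    rw [Finset.mem_filter] at hy
    exact Finset.mem_Icc.2 ⟨hy.2.2, hy.2.1⟩
  · intro y hy
    rw [Finset.mem_Icc] at hy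
    exact Finset.mem_filter.2 ⟨Finset.mem_univ _, hy.2, hy.1⟩
  · intro y _
    unfold moebius
    congr!

/-- Möbius inversion for weights distributed over the elements of a finite poset. -/
theorem sum_eq_sum_moebius {α κ : Type*} [PartialOrder α] [Fintype α] [Fintype κ]
    [DecidableLE α] (w : κ → α) (φ : κ → ℝ) (c h : α → ℝ) (hc : ∀ k, c (w k) ≠ 0)
    (hh : ∀ a, h a = ∑ k with w k ≤ a, φ k * c (w k)) :
    ∑ k, φ k = ∑ y, h y * ∑ a with y ≤ a, (moebius (toDual a) (toDual y) : ℝ) * (1 / c a) := by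
  classical
  calc ∑ k, φ k
      -- Write 1 as `c (w k) / c (w k)` through a delta function at `w k`, then replace the delta by
      -- the Möbius sum over the interval from `w k` to `a`.
      = ∑ k, φ k * c (w k) * ∑ a, 1 / c a * (if a = w k then 1 else 0) := by
        refine Finset.sum_congr rfl fun k _ => ?_
        rw [Finset.sum_eq_single (w k)]
        · field_simp [hc k]
          simp
        · intro a _ ha
          rw [if_neg ha, mul_zero]
        · simp
    _ = ∑ k, φ k * c (w k) * ∑ a, 1 / c a *
          ∑ y with w k ≤ y ∧ y ≤ a, (moebius (toDual a) (toDual y) : ℝ) := by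
        refine Finset.sum_congr rfl fun k _ => ?_
        congr 1
        refine Finset.sum_congr rfl fun a _ => ?_
        have := congrArg (Int.cast : ℤ → ℝ) (sum_moebius_toDual a (w k))
        push_cast at this
        rw [← this]
    _ = ∑ y, h y * ∑ a with y ≤ a, (moebius (toDual a) (toDual y) : ℝ) * (1 / c a) := by
        simp only [hh, Finset.sum_filter, Finset.mul_sum, Finset.sum_mul]
        rw [Finset.sum_comm' (s := Finset.univ) (t := fun _ => Finset.univ)
          (t' := Finset.univ) (s' := fun _ => Finset.univ) (by simp)]
        conv_rhs => rw [Finset.sum_comm]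
        refine Finset.sum_congr rfl fun a _ => ?_
        rw [Finset.sum_comm]
        refine Finset.sum_congr rfl fun y _ => ?_
        refine Finset.sum_congr rfl fun k _ => ?_
        by_cases h1 : w k ≤ y <;> by_cases h2 : y ≤ a <;> simp only [h1, h2, and_self,
          and_true, and_false, if_true, if_false, mul_zero, zero_mul]
        ring

end MoebiusInversion

/-! ### Determinants and covolumes in orthonormal coordinates -/

section Coordinates

variable {ι κ E N : Type*} [NormedAddCommGroup E] [InnerProductSpace ℝ E] [AddCommGroup N]
  [Module ℝ N]

/-- The volume of a zonotope in a Euclidean space. -/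
theorem factorial_mul_volume_zonotope_inner [FiniteDimensional ℝ E] [MeasurableSpace E]
    [BorelSpace E] {n : ℕ} (o : OrthonormalBasis (Fin n) ℝ E) (s : Finset κ) (v : κ → E) :
    (n.factorial : ℝ) * volume.real (zonotope s v) =
      ∑ f ∈ Fintype.piFinset fun _ : Fin n => s,
        |(Matrix.of fun j => o.toBasis.equivFun (v (f j))).det| := by
  have hmp : MeasurePreserving (o.toBasis.equivFun : E → Fin n → ℝ) := by
    have h : (o.toBasis.equivFun : E → Fin n → ℝ) = WithLp.ofLp ∘ o.repr := rfl
    rw [h]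
    exact (PiLp.volume_preserving_ofLp (Fin n)).comp o.measurePreserving_repr
  rw [← factorial_mul_volume_zonotope n s fun i => o.toBasis.equivFun (v i),
    measureReal_def, measureReal_def]
  have himg : o.toBasis.equivFun '' zonotope s v =
      zonotope s fun i => o.toBasis.equivFun (v i) :=
    image_zonotope (o.toBasis.equivFun : E →ₗ[ℝ] (Fin n → ℝ)) s v
  rw [← himg, ← hmp.measure_preimage, o.toBasis.equivFun.injective.preimage_image]
  rw [himg]
  exact (isCompact_zonotope s _).measurableSet.nullMeasurableSet

/-- The Cauchy-Binet formula for the Laplacian of a set of roots. -/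
theorem factorial_mul_det_laplacian [FiniteDimensional ℝ E] (P : RootPairing ι ℝ E N) {n : ℕ}
    (o : OrthonormalBasis (Fin n) ℝ E) (s : Finset ι) :
    (n.factorial : ℝ) * LinearMap.det (laplacian P s) =
      ∑ f ∈ Fintype.piFinset fun _ : Fin n => s,
        (Matrix.of fun j => o.toBasis.equivFun (P.root (f j))).det *
          (Matrix.of fun j => o.toBasis.equivFun (innerCoroot P (f j))).det := by
  rw [← factorial_mul_det_sum_vecMulVec s (fun i => o.toBasis.equivFun (P.root i))
    fun i => o.toBasis.equivFun (innerCoroot P i), ← LinearMap.det_toMatrix o.toBasis]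
  congr 2
  ext p q
  simp [LinearMap.toMatrix_apply, laplacian_apply, Matrix.sum_apply, Matrix.vecMulVec_apply,
    OrthonormalBasis.repr_apply_apply, real_inner_comm, mul_comm]

theorem det_innerCoroot (P : RootPairing ι ℝ E N) {n : ℕ} (o : OrthonormalBasis (Fin n) ℝ E)
    (f : Fin n → ι) :
    (Matrix.of fun j => o.toBasis.equivFun (innerCoroot P (f j))).det =
      (∏ j, 2 / ⟪P.root (f j), P.root (f j)⟫) *
        (Matrix.of fun j => o.toBasis.equivFun (P.root (f j))).det := by
  rw [← Matrix.det_mul_column]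
  congr 1
  ext j k
  simp [innerCoroot]

theorem covolume_span_basis [FiniteDimensional ℝ E] [MeasurableSpace E]
    [BorelSpace E] {n : ℕ} (o : OrthonormalBasis (Fin n) ℝ E) (B : Module.Basis (Fin n) ℝ E) :
    ZLattice.covolume (Submodule.span ℤ (Set.range B)) =
      |(Matrix.of fun j => o.toBasis.equivFun (B j)).det| := by
  have h := ZLattice.covolume_eq_measure_fundamentalDomain (Submodule.span ℤ (Set.range B)) volume
    (ZSpan.isAddFundamentalDomain B volume)
  have h1 : volume.real (ZSpan.fundamentalDomain o.toBasis) = 1 := by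
    rw [measureReal_congr (ZSpan.fundamentalDomain_ae_parallelepiped o.toBasis volume),
      OrthonormalBasis.coe_toBasis, measureReal_def, o.volume_parallelepiped]
    rfl
  rw [h, ZSpan.measureReal_fundamentalDomain B volume o.toBasis, h1, mul_one,
    Module.Basis.det_apply, ← Matrix.det_transpose]
  congr 2

end Coordinates

/-! ### Subgroups generated by bases of roots -/

section Assembly

variable {ι E N : Type*} [NormedAddCommGroup E] [InnerProductSpace ℝ E]
  [AddCommGroup N] [Module ℝ N] {P : RootPairing ι ℝ E N}

theorem generatedSubgroup_le_iff {κ : Type*} {f : κ → ι} {H : Subgroup P.weylGroup} :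
    generatedSubgroup (P := P) f ≤ H ↔ ∀ j, f j ∈ rootIndices P H := by
  rw [generatedSubgroup, Subgroup.closure_le, Set.range_subset_iff]
  rfl

theorem mem_rootIndices_generatedSubgroup {κ : Type*} (f : κ → ι) (j : κ) :
    f j ∈ rootIndices P (generatedSubgroup f) :=
  generatedSubgroup_le_iff.1 le_rfl j

theorem isReflectionSubgroup_generatedSubgroup {κ : Type*} (f : κ → ι) :
    IsReflectionSubgroup P (generatedSubgroup f) := by
  refine le_antisymm ((Subgroup.closure_le _).2 ?_) (Subgroup.closure_mono ?_)
  · rintro _ ⟨i, hi, rfl⟩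
    exact hi
  · rintro _ ⟨j, rfl⟩
    exact ⟨f j, mem_rootIndices_generatedSubgroup f j, rfl⟩

/-- The reflections in a basis of roots generate a reflection subgroup of maximal rank. -/
theorem rootRank_generatedSubgroup {κ : Type*} (f : κ → ι) (B : Module.Basis κ ℝ E)
    (hB : ∀ j, B j = P.root (f j)) :
    rootRank P (rootIndices P (generatedSubgroup f)) = Module.finrank ℝ E := by
  have h : Submodule.span ℝ (P.root '' rootIndices P (generatedSubgroup f)) = ⊤ := by
    rw [eq_top_iff, ← B.span_eq, Submodule.span_le]
    rintro _ ⟨j, rfl⟩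
    rw [hB]
    exact Submodule.subset_span ⟨f j, mem_rootIndices_generatedSubgroup f j, rfl⟩
  rw [rootRank, h, finrank_top]

theorem corootLattice_generatedSubgroup [FiniteDimensional ℝ E] [Finite ι] [P.IsRootSystem]
    [P.IsCrystallographic] [P.IsReduced] (hP : IsInvariantInner P) (b : P.Base)
    {κ : Type*} [Fintype κ] [DecidableEq κ] (f : κ → ι) (B : Module.Basis κ ℝ E)
    (hB : ∀ j, B j = P.root (f j)) :
    corootLattice P (generatedSubgroup f) =
      Submodule.span ℤ (Set.range fun j => innerCoroot P (f j)) := by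
  refine le_antisymm (Submodule.span_le.2 ?_) (Submodule.span_mono ?_)
  · rintro _ ⟨i, hi, rfl⟩
    exact innerCoroot_mem_span hP b f B hB hi
  · rintro _ ⟨j, rfl⟩
    exact ⟨f j, mem_rootIndices_generatedSubgroup f j, rfl⟩

theorem exists_basis_of_det_ne_zero {n : ℕ} (o : OrthonormalBasis (Fin n) ℝ E) {v : Fin n → E}
    (hv : (Matrix.of fun j => o.toBasis.equivFun (v j)).det ≠ 0) :
    ∃ B : Module.Basis (Fin n) ℝ E, ⇑B = v := by
  have h : IsUnit (o.toBasis.det v) := by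
    rw [isUnit_iff_ne_zero, Module.Basis.det_apply, ← Matrix.det_transpose]
    exact hv
  obtain ⟨hli, hsp⟩ := (Module.Basis.is_basis_iff_det o.toBasis).2 h
  exact ⟨Module.Basis.mk hli hsp.ge, Module.Basis.coe_mk _ _⟩

theorem covolume_corootLattice_generatedSubgroup [FiniteDimensional ℝ E] [MeasurableSpace E]
    [BorelSpace E] [Finite ι] [P.IsRootSystem] [P.IsCrystallographic] [P.IsReduced]
    (hP : IsInvariantInner P) (b : P.Base) {n : ℕ} (o : OrthonormalBasis (Fin n) ℝ E)
    (f : Fin n → ι) (hf : (Matrix.of fun j => o.toBasis.equivFun (P.root (f j))).det ≠ 0) :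
    ZLattice.covolume (corootLattice P (generatedSubgroup f)) =
      |(Matrix.of fun j => o.toBasis.equivFun (innerCoroot P (f j))).det| := by
  obtain ⟨B, hB⟩ := exists_basis_of_det_ne_zero o hf
  have hf' : (Matrix.of fun j => o.toBasis.equivFun (innerCoroot P (f j))).det ≠ 0 := by
    rw [det_innerCoroot]
    exact mul_ne_zero (Finset.prod_ne_zero_iff.2 fun j _ =>
      (div_pos two_pos (inner_root_self_pos P _)).ne') hf
  obtain ⟨B', hB'⟩ := exists_basis_of_det_ne_zero o hf'
  rw [corootLattice_generatedSubgroup hP b f B fun j => congrFun hB j, ← hB',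
    covolume_span_basis o B', hB']

end Assembly

end WeylZonotope

/-! ### The volume formula -/

open scoped Classical in
theorem mainTheorem6 {ι E N : Type*} [Finite ι]
    [NormedAddCommGroup E] [InnerProductSpace ℝ E] [FiniteDimensional ℝ E]
    [MeasurableSpace E] [BorelSpace E] [AddCommGroup N] [Module ℝ N]
    (P : RootPairing ι ℝ E N) [P.IsRootSystem] [P.IsCrystallographic] [P.IsReduced]
    (hP : ∀ (i : ι) (x y : E), ⟪P.reflection i x, P.reflection i y⟫ = ⟪x, y⟫)
    (b : P.Base) :
    volume.real (WeylZonotope.rootZonotope P b) =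
      ∑ W'' : WeylZonotope.MaxRankReflectionSubgroup P,
        (WeylZonotope.coxeterNumbers P W''.1).prod *
          ∑ W' : WeylZonotope.MaxRankReflectionSubgroup P with W'' ≤ W',
            (WeylZonotope.moebius (toDual W') (toDual W'') : ℝ) *
              (1 / ZLattice.covolume (WeylZonotope.corootLattice P W'.1)) := by
  have : Fintype ι := Fintype.ofFinite ι
  set n := Module.finrank ℝ E
  let o : OrthonormalBasis (Fin n) ℝ E := stdOrthonormalBasis ℝ E
  let D : (Fin n → ι) → ℝ := fun f => (Matrix.of fun j => o.toBasis.equivFun (P.root (f j))).det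
  let D' : (Fin n → ι) → ℝ := fun f =>
    (Matrix.of fun j => o.toBasis.equivFun (WeylZonotope.innerCoroot P (f j))).det
  let pos : Finset ι := {i | b.IsPos i}
  -- Ordered bases of positive roots; `w` sends each to the subgroup generated by its reflections.
  let κ := {f : Fin n → ι // (∀ j, b.IsPos (f j)) ∧ D f ≠ 0}
  let w : κ → WeylZonotope.MaxRankReflectionSubgroup P := fun f =>
    ⟨WeylZonotope.generatedSubgroup f.1,
      WeylZonotope.isReflectionSubgroup_generatedSubgroup f.1, by
      obtain ⟨B, hB⟩ := WeylZonotope.exists_basis_of_det_ne_zero o f.2.2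
      exact WeylZonotope.rootRank_generatedSubgroup f.1 B fun j => congrFun hB j⟩
  let c : WeylZonotope.MaxRankReflectionSubgroup P → ℝ := fun W =>
    ZLattice.covolume (WeylZonotope.corootLattice P W.1)
  have hcov : ∀ f : κ, c (w f) = |D' f.1| := fun f =>
    WeylZonotope.covolume_corootLattice_generatedSubgroup hP b o f.1 f.2.2
  have hDD' : ∀ f : Fin n → ι, D f * D' f = |D f| * |D' f| := by
    intro f
    rw [← abs_mul, abs_of_nonneg]
    simp only [D, D', WeylZonotope.det_innerCoroot]
    rw [mul_left_comm]
    exact mul_nonneg (Finset.prod_nonneg fun j _ =>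
      (div_pos two_pos (WeylZonotope.inner_root_self_pos P _)).le) (mul_self_nonneg _)
  have hc0 : ∀ f : κ, c (w f) ≠ 0 := by
    intro f
    rw [hcov, abs_ne_zero]
    simp only [D', WeylZonotope.det_innerCoroot]
    exact mul_ne_zero (Finset.prod_ne_zero_iff.2 fun j _ =>
      (div_pos two_pos (WeylZonotope.inner_root_self_pos P _)).ne') f.2.2
  have hvol : (n.factorial : ℝ) * volume.real (WeylZonotope.rootZonotope P b) =
      ∑ f : κ, |D f.1| := by
    have h1 : WeylZonotope.rootZonotope P b = WeylZonotope.zonotope pos P.root := by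
      unfold WeylZonotope.rootZonotope
      congr!
    rw [h1, WeylZonotope.factorial_mul_volume_zonotope_inner o,
      ← Finset.sum_subtype (p := fun f : Fin n → ι => (∀ j, b.IsPos (f j)) ∧ D f ≠ 0)
        {f | (∀ j, b.IsPos (f j)) ∧ D f ≠ 0} (by simp) fun f => |D f|]
    symm
    apply Finset.sum_subset
    · intro f hf
      simp only [Finset.mem_filter, Finset.mem_univ, true_and] at hf
      simpa [pos] using hf.1
    · intro f hf hf'
      simp only [Fintype.mem_piFinset, pos, Finset.mem_filter, Finset.mem_univ, true_and,
        not_and_not_right] at hf hf'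
      by_contra h
      exact h (abs_eq_zero.2 (by simpa using hf' hf))
  -- Cauchy-Binet for the positive roots of `W`: a tuple consists of roots of `W` exactly when the
  -- subgroup it generates lies in `W`, and tuples with zero determinant drop out.
  have hcox : ∀ W : WeylZonotope.MaxRankReflectionSubgroup P,
      (n.factorial : ℝ) * (WeylZonotope.coxeterNumbers P W.1).prod =
        ∑ f : κ with w f ≤ W, |D f.1| * c (w f) := by
    intro W
    rw [← WeylZonotope.det_laplacian hP b W.2.2
      (S := {i | i ∈ WeylZonotope.rootIndices P W.1 ∧ b.IsPos i}) (by simp),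
      WeylZonotope.factorial_mul_det_laplacian P o]
    simp only [hcov]
    rw [Finset.sum_filter]
    change _ = ∑ f : κ, if WeylZonotope.generatedSubgroup f.1 ≤ W.1 then |D f.1| * |D' f.1| else 0
    rw [← Finset.sum_subtype (p := fun f : Fin n → ι => (∀ j, b.IsPos (f j)) ∧ D f ≠ 0)
        {f | (∀ j, b.IsPos (f j)) ∧ D f ≠ 0} (by simp) fun f =>
          if WeylZonotope.generatedSubgroup f ≤ W.1 then |D f| * |D' f| else 0,
      ← Finset.sum_filter, Finset.filter_filter]
    symm
    rw [Finset.sum_congr rfl fun f _ => (hDD' f).symm]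
    apply Finset.sum_subset
    · intro f hf
      simp only [Finset.mem_filter, Finset.mem_univ, true_and,
        WeylZonotope.generatedSubgroup_le_iff] at hf
      simpa using fun j => ⟨hf.2 j, hf.1.1 j⟩
    · intro f hf hf'
      simp only [Fintype.mem_piFinset, Finset.mem_filter, Finset.mem_univ, true_and,
        WeylZonotope.generatedSubgroup_le_iff] at hf hf'
      have h0 : D f = 0 := by
        by_contra h
        exact hf' ⟨⟨fun j => (hf j).2, h⟩, fun j => (hf j).1⟩
      rw [h0, zero_mul]
  have hfac : (n.factorial : ℝ) ≠ 0 := by exact_mod_cast n.factorial_ne_zero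
  apply mul_left_cancel₀ hfac
  rw [hvol, WeylZonotope.sum_eq_sum_moebius w (fun f => |D f.1|) c
    (fun W => (n.factorial : ℝ) * (WeylZonotope.coxeterNumbers P W.1).prod) hc0 hcox,
    Finset.mul_sum]
  exact Finset.sum_congr rfl fun W _ => mul_assoc _ _ _
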